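/- **Model.** Let the state set be $X=\{0,1\}\cup S$, where $0,1$ are the boundary states and $S=\{2,\dots,N\}$, $N<\infty$, is the finite set of internal (admissible) states. Let $\xi$ be a semi-Markov process with absorption on $X$, for which $0$ and $1$ are absorbing: for each $k\in S$ the joint law of the duration ($\ge 0$) of a single stay in $k$, of the income obtained during that stay and of the next state in $X$ is given, and, given the current state, a stay and the transition at its end are independent of the past. For $k\in S$ let $b_{k0},b_{k1}$ be the probabilities that $\xi$, started in $k$, is absorbed in $0$, respectively $1$, and let $m_k$ and $r_k$ be the expected time and the expected income until absorption. The controlled process evolves as $\xi$ in the internal states. Whenever it hits a boundary state $i\in\{0,1\}$, a control action is applied: a state $k\in S$ is drawn from the control distribution $\alpha^{(i)}=(\alpha^{(i)}_k)_{k\in S}$, the transfer to $k$ takes a random time ($\ge 0$) and yields a random (possibly negative) income whose joint law depends only on $(i,k)$ and whose means are $\mu^{(i)}_k$ and $d^{(i)}_k$; then the process starts afresh from $k$, independently of the past. All mean durations are assumed finite, and within each stay and each control action the maximal absolute value of the income obtained so far has finite mean. Let $V(t)$ be the expected income obtained by the controlled process in $[0,t]$. **Theorem 2.** Assume that $b_{k0}>0$,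 $b_{k1}>0$ and $b_{k0}+b_{k1}=1$ for all $k\in S$, and let $\alpha^{(0)},\alpha^{(1)}$ be probability distributions on $S$ for which the denominator below is non-zero. Then, for every initial state in $X$, almost surely only finitely many stays begin in each bounded time interval, the income obtained in $[0,t]$ is integrable for every $t$, and the stationary mean specific profit $I=\lim_{t\to\infty}V(t)/t$ exists and equals $$ I=\frac{\sum_{k=2}^N\alpha_k^{(0)}\bigl[d_k^{(0)}+r_k\bigr]\sum_{l=2}^N\alpha_l^{(1)}b_{l0}+\sum_{k=2}^N\alpha_k^{(1)}\bigl[d_k^{(1)}+r_k\bigr]\sum_{l=2}^N\alpha_l^{(0)}(1-b_{l0})}{\sum_{k=2}^N\alpha_k^{(0)}\bigl[\mu_k^{(0)}+m_k\bigr]\sum_{l=2}^N\alpha_l^{(1)}b_{l0}+\sum_{k=2}^N\alpha_k^{(1)}\bigl[\mu_k^{(1)}+m_k\bigr]\sum_{l=2}^N\alpha_l^{(0)}(1-b_{l0})}. $$ -/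

import Mathlib

open MeasureTheory Filter Topology

noncomputable section

namespace Tuning

/-- The state set: two boundary states `Sum.inl 0`, `Sum.inl 1` and the finite set `S` of internal
(admissible) states `Sum.inr k`. -/
abbrev State (S : Type*) := Fin 2 ⊕ S

/-! ### Semi-Markov processes with marked stays

A semi-Markov process with finitely many states is given by its semi-Markov kernel: for every
state `x`, the joint law `κ x` of the next state of the embedded chain and of the mark of the stay
in `x`. The mark is the complete random outcome of one stay; its duration and the income obtained
during it are functions of the mark.  The process is realised on the sample space of independent
draws `ω n x ∼ κ x`, where `ω n x` is the outcome of the `n`-th stay if it takes place in `x`. -/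

section SemiMarkov

variable {X M : Type*}

/-- Embedded Markov chain: the state of the process during its `n`-th stay, started from `x₀`. -/
def chain (x₀ : X) (ω : ℕ → X → X × M) : ℕ → X
  | 0 => x₀
  | n + 1 => (ω n (chain x₀ ω n)).1

/-- The mark of the `n`-th stay. -/
def mark (x₀ : X) (ω : ℕ → X → X × M) (n : ℕ) : M := (ω n (chain x₀ ω n)).2

/-- The law of the independent draws that drive the process with semi-Markov kernel `κ`. -/
def drawLaw [Fintype X] [MeasurableSpace X] [MeasurableSpace M] (κ : X → Measure (X × M)) :
    Measure (ℕ → X → X × M) :=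
  Measure.infinitePi fun _ : ℕ => Measure.pi κ

end SemiMarkov

/-! ### The model -/

/-- The primary data of the continuous-time model, without the control distributions. -/
structure Model (S M : Type*) [MeasurableSpace S] [MeasurableSpace M] where
  /-- Semi-Markov kernel on the admissible states: joint law of the next state and of the mark of
  a single stay in the admissible state `k`. -/
  stay : S → Measure (State S × M)
  /-- Law of the mark of a control action that transfers the process from the boundary state `i`
  into the admissible state `k`. -/
  control : Fin 2 → S → Measure M
  /-- Duration of a stay (or of a control action) with a given mark. -/
  dur : M → ℝ
  /-- `income m u` is the income obtained by the time `u ∈ [0, dur m]` elapsed since the beginning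
  of a stay (or control action) with mark `m`; the total income is `income m (dur m)`. Costs count
  as negative income. -/
  income : M → ℝ → ℝ
  stay_prob : ∀ k, IsProbabilityMeasure (stay k)
  control_prob : ∀ i k, IsProbabilityMeasure (control i k)
  dur_measurable : Measurable dur
  dur_nonneg : ∀ m, 0 ≤ dur m
  income_measurable : Measurable (Function.uncurry income)
  /-- Mean durations are finite. -/
  dur_integrable_stay : ∀ k, Integrable (fun p => dur p.2) (stay k)
  dur_integrable_control : ∀ i k, Integrable dur (control i k)
  /-- Mean incomes are finite, also for interrupted stays: the largest absolute income obtained up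
  to some time of a single stay or control action has a finite mean. -/
  income_dominated : ∃ B : M → ℝ,
    (∀ m u, 0 ≤ u → u ≤ dur m → |income m u| ≤ B m) ∧
    (∀ k, Integrable (fun p => B p.2) (stay k)) ∧ (∀ i k, Integrable B (control i k))

namespace Model

variable {S M : Type*} [Fintype S] [MeasurableSpace S] [MeasurableSpace M]

/-- `μ_k^{(i)}`: mean duration of a control action from boundary state `i` into `k`. -/
def controlTime (D : Model S M) (i : Fin 2) (k : S) : ℝ := ∫ m, D.dur m ∂(D.control i k)

/-- `d_k^{(i)}`: mean (signed) income of a control action from boundary state `i` into `k`. -/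
def controlCost (D : Model S M) (i : Fin 2) (k : S) : ℝ :=
  ∫ m, D.income m (D.dur m) ∂(D.control i k)

/-! ### The semi-Markov process with absorption -/

/-- Semi-Markov kernel of the process with absorption: a boundary state is never left (the marks
given to it are irrelevant). -/
def absorbedKernel [Nonempty M] (D : Model S M) : State S → Measure (State S × M)
  | Sum.inl i => Measure.dirac (Sum.inl i, Classical.arbitrary M)
  | Sum.inr k => D.stay k

/-- Time until absorption: total duration of the stays in admissible states. -/
def absorptionTime (D : Model S M) (k : S) (ω : ℕ → State S → State S × M) : ℝ :=
  ∑' n, if (chain (Sum.inr k) ω n).isRight then D.dur (mark (Sum.inr k) ω n) else 0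

/-- Income until absorption: total income of the stays in admissible states. -/
def absorptionIncome (D : Model S M) (k : S) (ω : ℕ → State S → State S × M) : ℝ :=
  ∑' n, if (chain (Sum.inr k) ω n).isRight then
    D.income (mark (Sum.inr k) ω n) (D.dur (mark (Sum.inr k) ω n)) else 0

/-- `m_k`: mean time until absorption from the admissible state `k`. -/
def meanTime [Nonempty M] (D : Model S M) (k : S) : ℝ :=
  ∫ ω, D.absorptionTime k ω ∂(drawLaw D.absorbedKernel)

/-- `r_k`: mean income until absorption from the admissible state `k`. -/
def meanIncome [Nonempty M] (D : Model S M) (k : S) : ℝ :=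
  ∫ ω, D.absorptionIncome k ω ∂(drawLaw D.absorbedKernel)

/-- `b_{ki}`: probability of absorption in the boundary state `i` from the admissible
state `k`. -/
def absorptionProb [Nonempty M] (D : Model S M) (k : S) (i : Fin 2) : ℝ :=
  (drawLaw D.absorbedKernel).real {ω | ∃ n, chain (Sum.inr k) ω n = Sum.inl i}

/-! ### The controlled process -/

/-- Semi-Markov kernel of the controlled process with control distributions `α 0`, `α 1`. In an
admissible state the process moves as the process with absorption; in the boundary state `i` a
target `k` is drawn from `α i`, then the mark of the control action is drawn from `control i k`,
and at the end of the action the process enters `k`. -/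
def controlledKernel (D : Model S M) (α : Fin 2 → stdSimplex ℝ S) :
    State S → Measure (State S × M)
  | Sum.inl i => ∑ k, ENNReal.ofReal ((α i).1 k) • (D.control i k).map (fun m => (Sum.inr k, m))
  | Sum.inr k => D.stay k

/-- The time `t_n` at which the `n`-th stay (in an admissible state or in a control action)
begins. -/
def jumpTime (D : Model S M) (x₀ : State S) (ω : ℕ → State S → State S × M) (n : ℕ) : ℝ :=
  ∑ j ∈ Finset.range n, D.dur (mark x₀ ω j)

/-- The additive (accumulation) functional: the income obtained in the time interval `[0, t]`.
Each stay begun by time `t` contributes the income obtained during it up to time `t`. -/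
def accumulated (D : Model S M) (x₀ : State S) (t : ℝ) (ω : ℕ → State S → State S × M) : ℝ :=
  ∑' n, if D.jumpTime x₀ ω n ≤ t then
    D.income (mark x₀ ω n) (min (t - D.jumpTime x₀ ω n) (D.dur (mark x₀ ω n))) else 0

/-- `V(t)`: the mean income of the controlled process in `[0, t]`, started from `x₀`. -/
def V (D : Model S M) (α : Fin 2 → stdSimplex ℝ S) (x₀ : State S) (t : ℝ) : ℝ :=
  ∫ ω, D.accumulated x₀ t ω ∂(drawLaw (D.controlledKernel α))

/-! The kernels consist of probability measures, so that `drawLaw` is a probability measure. -/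

instance absorbedKernel_prob [Nonempty M] (D : Model S M) (x : State S) :
    IsProbabilityMeasure (D.absorbedKernel x) := by
  cases x with
  | inl i => exact inferInstanceAs (IsProbabilityMeasure (Measure.dirac _))
  | inr k => exact D.stay_prob k

instance controlledKernel_prob (D : Model S M) (α : Fin 2 → stdSimplex ℝ S) (x : State S) :
    IsProbabilityMeasure (D.controlledKernel α x) := by
  cases x with
  | inr k => exact D.stay_prob k
  | inl i =>
    constructor
    have h : ∀ k, ((D.control i k).map
        (fun m => ((Sum.inr k : State S), m))) Set.univ = 1 := fun k => by
      have := D.control_prob i k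
      rw [Measure.map_apply (by fun_prop) MeasurableSet.univ]
      simp
    simp only [controlledKernel, Measure.coe_finsetSum, Finset.sum_apply, Measure.smul_apply, h,
      smul_eq_mul, mul_one]
    rw [← ENNReal.ofReal_sum_of_nonneg (fun k _ => (α i).2.1 k), (α i).2.2, ENNReal.ofReal_one]

end Model

end Tuning

end

noncomputable section

namespace Tuning

set_option linter.unusedSectionVars false

/-! The proof uses Poisson equations for the embedded chain together with optional stopping; it
needs neither a stationary law nor a renewal theorem. The event that the `n`-th stay begins by time
`t` is decided by the first `n` draws (`past`). Summed over the begun stays, a one-stay reward can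
therefore be replaced in the mean by its conditional mean at the current state
(`setIntegral_outcome`).

Absorption with probability one makes `1 - D.inner` invertible, and its inverse is the Green matrix,
which yields the mean totals until absorption. Solving the Poisson equation inside `S` and matching
the two boundary values leaves a single solvability condition, `balance = 0` (`exists_poisson`). The
balances of mean income and mean duration are exactly the numerator and the denominator of the
formula, so income minus `num / den` times duration is solvable.

With `h` its solution, income minus `num / den` times duration plus the increment of `h` has
conditional mean zero at every stay. Summed over the stays begun by `t`, the increments of `h`
telescope to a bounded quantity and the elapsed durations add up to `t`; only the stay in progress
leaves an error. That error is `o(t)` in the mean provided the expected number of begun stays is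
`O(1 + t)` (`abs_V_sub_le`, `tendsto_V_div`). As stays may have duration zero, this needs proof: a
second Poisson equation, for truncated durations, gives a positive drift at every state
(`exists_renewal_bound`). The same bound yields non-explosion and integrability. -/

/-! ### Markov property of the embedded chain -/

section Markov

variable {X M : Type*} [MeasurableSpace X] [MeasurableSpace M]

/-- The sigma-algebra generated by the first `n` draws. -/
@[reducible] def past (X M : Type*) [MeasurableSpace X] [MeasurableSpace M] (n : ℕ) :
    MeasurableSpace (ℕ → X → X × M) :=
  ⨆ j ∈ Set.Iio n, MeasurableSpace.comap (fun ω : ℕ → X → X × M => ω j) inferInstance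

theorem past_le (n : ℕ) : past X M n ≤ MeasurableSpace.pi :=
  iSup₂_le fun j _ => (measurable_pi_apply j).comap_le

theorem past_mono {m n : ℕ} (h : m ≤ n) : past X M m ≤ past X M n :=
  biSup_mono fun _ hj => lt_of_lt_of_le hj h

theorem measurable_draw_past {j n : ℕ} (h : j < n) :
    Measurable[past X M n] (fun ω : ℕ → X → X × M => ω j) :=
  (comap_measurable _).mono (le_iSup₂_of_le (f := fun j (_ : j ∈ Set.Iio n) =>
    MeasurableSpace.comap (fun ω : ℕ → X → X × M => ω j) inferInstance) j h le_rfl) le_rfl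

/-- Evaluation at a random index is measurable because countably many index values reduce it to
fixed coordinates. This is what makes `chain` and `mark` measurable. -/
theorem measurable_apply_of_countable {X Y : Type*} [MeasurableSpace X] [MeasurableSpace Y]
    [Countable X] [MeasurableSingletonClass X] :
    Measurable (fun p : X × (X → Y) => p.2 p.1) :=
  measurable_from_prod_countable_right fun x => measurable_pi_apply x

variable [Countable X] [MeasurableSingletonClass X] (x₀ : X)

/-- The state of the `n`-th stay uses only draws with index below `n`, so it is independent of draw
`n`; the Markov property rests on this. -/
theorem measurable_chain_past (n : ℕ) :
    Measurable[past X M n] (fun ω : ℕ → X → X × M => chain x₀ ω n) := by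
  induction n with
  | zero => exact @measurable_const _ _ _ (past X M 0) _
  | succ n ih =>
    have h1 : Measurable[past X M (n + 1)] (fun ω : ℕ → X → X × M => (chain x₀ ω n, ω n)) :=
      @Measurable.prodMk _ (past X M (n + 1)) _ _ _ _
        (fun ω => chain x₀ ω n) (fun ω : ℕ → X → X × M => ω n) (ih.mono (past_mono n.le_succ) le_rfl)
        (measurable_draw_past n.lt_succ_self)
    exact measurable_fst.comp (measurable_apply_of_countable.comp h1)

theorem measurable_outcome_past {j n : ℕ} (h : j < n) :
    Measurable[past X M n] (fun ω : ℕ → X → X × M => ω j (chain x₀ ω j)) := by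
  have h1 : Measurable[past X M n] (fun ω : ℕ → X → X × M => (chain x₀ ω j, ω j)) :=
    @Measurable.prodMk _ (past X M n) _ _ _ _ (fun ω => chain x₀ ω j)
      (fun ω : ℕ → X → X × M => ω j)
      ((measurable_chain_past x₀ j).mono (past_mono h.le) le_rfl) (measurable_draw_past h)
  exact measurable_apply_of_countable.comp h1

theorem measurable_mark_past {j n : ℕ} (h : j < n) :
    Measurable[past X M n] (fun ω : ℕ → X → X × M => mark x₀ ω j) :=
  measurable_snd.comp (measurable_outcome_past x₀ h)

theorem measurable_chain (n : ℕ) : Measurable (fun ω : ℕ → X → X × M => chain x₀ ω n) :=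
  (measurable_chain_past x₀ n).mono (past_le n) le_rfl

theorem measurable_mark (n : ℕ) : Measurable (fun ω : ℕ → X → X × M => mark x₀ ω n) :=
  (measurable_mark_past x₀ n.lt_succ_self).mono (past_le _) le_rfl

end Markov

section MarkovLaw

variable {X M : Type*} [Fintype X] [MeasurableSpace X] [MeasurableSingletonClass X]
  [MeasurableSpace M] (κ : X → Measure (X × M)) [∀ x, IsProbabilityMeasure (κ x)] (x₀ : X)

instance : IsProbabilityMeasure (drawLaw κ) :=
  inferInstanceAs (IsProbabilityMeasure (Measure.infinitePi fun _ : ℕ => Measure.pi κ))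

theorem indep_past_draw (n : ℕ) :
    ProbabilityTheory.Indep (past X M n)
      (MeasurableSpace.comap (fun ω : ℕ → X → X × M => ω n) inferInstance) (drawLaw κ) := by
  have h : ProbabilityTheory.iIndepFun (fun (n : ℕ) (ω : ℕ → X → X × M) => ω n) (drawLaw κ) :=
    ProbabilityTheory.iIndepFun_infinitePi (P := fun _ : ℕ => Measure.pi κ)
      (X := fun _ w => w) fun _ => measurable_id
  have := ProbabilityTheory.indep_iSup_of_disjoint (fun i => (measurable_pi_apply i).comap_le)
    h (S := Set.Iio n) (T := {n}) (by simp)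
  simpa [past] using this

theorem map_draw_apply (n : ℕ) (x : X) :
    (drawLaw κ).map (fun ω => ω n x) = κ x := by
  have h1 : (drawLaw κ).map (fun ω => ω n) = Measure.pi κ := Measure.infinitePi_map_eval _ n
  have h2 : (Measure.pi κ).map (fun w => w x) = κ x := (measurePreserving_eval κ x).map_eq
  rw [← h2, ← h1, Measure.map_map (measurable_pi_apply x) (measurable_pi_apply n)]
  rfl

variable {κ} {g : X → X × M → ℝ}

theorem integrable_draw (hg : ∀ x, Integrable (g x) (κ x)) (n : ℕ) (x : X) :
    Integrable (fun ω => g x (ω n x)) (drawLaw κ) := by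
  have h := hg x
  rw [← map_draw_apply κ n x] at h
  exact h.comp_measurable (by fun_prop)

/-- Splitting by the current state turns the draw at a random state into draws at fixed states, each
multiplied by the indicator of a past event; independence then applies term by term. -/
theorem outcome_eq_sum (n : ℕ) (ω : ℕ → X → X × M) :
    g (chain x₀ ω n) (ω n (chain x₀ ω n)) =
      ∑ x, {ω | chain x₀ ω n = x}.indicator (fun ω => g x (ω n x)) ω := by
  classical
  simp [Set.indicator_apply]

theorem integrable_outcome (hg : ∀ x, Integrable (g x) (κ x)) (n : ℕ) :
    Integrable (fun ω => g (chain x₀ ω n) (ω n (chain x₀ ω n))) (drawLaw κ) := by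
  simp_rw [outcome_eq_sum]
  exact integrable_finsetSum _ fun x _ => (integrable_draw hg n x).indicator
    (measurable_chain x₀ n (measurableSet_singleton x))

/-- Markov property: given the first `n` draws, the outcome of the `n`-th stay has the law
prescribed by the kernel at the current state. -/
theorem setIntegral_outcome (hg : ∀ x, Integrable (g x) (κ x)) {n : ℕ}
    {A : Set (ℕ → X → X × M)} (hA : MeasurableSet[past X M n] A) :
    ∫ ω in A, g (chain x₀ ω n) (ω n (chain x₀ ω n)) ∂(drawLaw κ) =
      ∑ x, (drawLaw κ).real (A ∩ {ω | chain x₀ ω n = x}) * ∫ p, g x p ∂(κ x) := by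
  have hc : ∀ x, MeasurableSet[past X M n] {ω : ℕ → X → X × M | chain x₀ ω n = x} := fun x =>
    measurable_chain_past x₀ n (measurableSet_singleton x)
  simp_rw [outcome_eq_sum]
  rw [integral_finsetSum _ fun x _ => ((integrable_draw hg n x).indicator
    (past_le n _ (hc x))).integrableOn]
  refine Finset.sum_congr rfl fun x _ => ?_
  rw [setIntegral_indicator (past_le n _ (hc x))]
  have hmap := (hg x).aestronglyMeasurable
  have hx : Measurable (fun ω : ℕ → X → X × M => ω n x) := by fun_prop
  have hi := ProbabilityTheory.Indep.setIntegral_eq_mul (past_le n)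
    (f := g x) (X := fun ω : ℕ → X → X × M => ω n x) (P := drawLaw κ)
    (A := A ∩ {ω | chain x₀ ω n = x})
    (ProbabilityTheory.indep_of_indep_of_le_right (indep_past_draw κ n) (by
      have := MeasurableSpace.comap_mono (g := fun ω : ℕ → X → X × M => ω n)
        (measurable_pi_apply (X := fun _ : X => X × M) x).comap_le
      rwa [MeasurableSpace.comap_comp] at this))
    hx.aemeasurable (@MeasurableSet.inter _ (past X M n) _ _ hA (hc x))
    (by rw [map_draw_apply]; exact hmap)
  rw [hi]
  congr 1
  rw [← integral_map (φ := fun ω : ℕ → X → X × M => ω n x) hx.aemeasurable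
    (by rw [map_draw_apply]; exact hmap), map_draw_apply]

theorem sum_real_inter_chain {n : ℕ} {A : Set (ℕ → X → X × M)}
    (hA : MeasurableSet[past X M n] A) :
    ∑ x, (drawLaw κ).real (A ∩ {ω | chain x₀ ω n = x}) = (drawLaw κ).real A := by
  have h := setIntegral_outcome (κ := κ) (g := fun _ _ => 1) x₀ (fun _ => integrable_const _) hA
  simpa using h.symm

/-- Sums of outcomes over predictable events are bounded by the worst one-stay mean. -/
theorem setIntegral_outcome_le (hg : ∀ x, Integrable (g x) (κ x)) {n : ℕ} {c : ℝ}
    (hc : ∀ x, ∫ p, g x p ∂(κ x) ≤ c)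
    {A : Set (ℕ → X → X × M)} (hA : MeasurableSet[past X M n] A) :
    ∫ ω in A, g (chain x₀ ω n) (ω n (chain x₀ ω n)) ∂(drawLaw κ) ≤ c * (drawLaw κ).real A := by
  rw [setIntegral_outcome x₀ hg hA, ← sum_real_inter_chain x₀ hA, Finset.mul_sum]
  refine Finset.sum_le_sum fun x _ => ?_
  rw [mul_comm]
  exact mul_le_mul_of_nonneg_right (hc x) measureReal_nonneg

theorem le_setIntegral_outcome (hg : ∀ x, Integrable (g x) (κ x)) {n : ℕ} {c : ℝ}
    (hc : ∀ x, c ≤ ∫ p, g x p ∂(κ x))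
    {A : Set (ℕ → X → X × M)} (hA : MeasurableSet[past X M n] A) :
    c * (drawLaw κ).real A ≤ ∫ ω in A, g (chain x₀ ω n) (ω n (chain x₀ ω n)) ∂(drawLaw κ) := by
  have h := setIntegral_outcome_le (κ := κ) (g := fun x p => -g x p) x₀ (fun x => (hg x).neg)
    (c := -c) (fun x => by rw [integral_neg]; exact neg_le_neg (hc x)) hA
  rw [integral_neg] at h
  linarith

variable (κ) in
/-- Transition matrix of the embedded chain. -/
def transition : Matrix X X ℝ := fun x y => (κ x).real (Prod.fst ⁻¹' {y})

theorem integral_next (h : X → ℝ) (x : X) :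
    ∫ p, h p.1 ∂(κ x) = ∑ y, transition κ x y * h y := by
  have := (κ x).isProbabilityMeasure_map (f := (Prod.fst : X × M → X)) (by fun_prop)
  rw [← integral_map (φ := Prod.fst) (f := h) (by fun_prop) (by fun_prop), integral_fintype]
  · simp [transition, map_measureReal_apply, measurable_fst]
  · exact Integrable.of_finite

theorem integrable_next (h : X → ℝ) (x : X) : Integrable (fun p => h p.1) (κ x) := by
  have := (κ x).isProbabilityMeasure_map (f := (Prod.fst : X × M → X)) (by fun_prop)
  exact (Integrable.of_finite (μ := (κ x).map Prod.fst) (f := h)).comp_measurable measurable_fst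

theorem law_chain [DecidableEq X] (n : ℕ) (y : X) :
    (drawLaw κ).real {ω | chain x₀ ω n = y} = (transition κ ^ n) x₀ y := by
  induction n generalizing y with
  | zero =>
    by_cases h : x₀ = y <;> simp [chain, h]
  | succ n ih =>
    have h := setIntegral_outcome (κ := κ) (n := n) (A := Set.univ)
      (g := fun _ p => if p.1 = y then 1 else 0) x₀
      (fun x => integrable_next (fun z => if z = y then 1 else 0) x) (@MeasurableSet.univ _ _)
    rw [pow_succ, Matrix.mul_apply]
    simp only [Set.univ_inter, ih] at h
    convert! h using 1
    · have : MeasurableSet {ω : ℕ → X → X × M | chain x₀ ω (n + 1) = y} :=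
        measurable_chain x₀ (n + 1) (measurableSet_singleton y)
      rw [Measure.restrict_univ, ← integral_indicator_one this]
      simp only [Set.indicator_apply, Set.mem_ofPred_eq, Pi.one_apply]
      rfl
    · refine Finset.sum_congr rfl fun x _ => ?_
      rw [integral_next (fun z => if z = y then 1 else 0)]
      simp

end MarkovLaw

/-! ### Absorption -/

namespace Model

variable {S M : Type*} [Fintype S] [MeasurableSpace S] [MeasurableSingletonClass S]
  [MeasurableSpace M]

instance : MeasurableSingletonClass (State S) where
  measurableSet_singleton x := by
    rcases x with i | k
    · rw [← Set.image_singleton]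
      exact (measurableSet_singleton i).inl_image
    · rw [← Set.image_singleton]
      exact (measurableSet_singleton k).inr_image

/-- Transition matrix between admissible states. -/
def inner (D : Model S M) : Matrix S S ℝ := fun k l => (D.stay k).real (Prod.fst ⁻¹' {Sum.inr l})

/-- Probability that a stay in `k` ends with a transition into the boundary state `i`. -/
def exitProb (D : Model S M) (k : S) (i : Fin 2) : ℝ :=
  (D.stay k).real (Prod.fst ⁻¹' {Sum.inl i})

section

variable [Nonempty M] (D : Model S M) [DecidableEq S]

theorem transition_absorbed_inl (i : Fin 2) (y : State S) :
    transition D.absorbedKernel (Sum.inl i) y = if y = Sum.inl i then 1 else 0 := by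
  have hm : MeasurableSet (Prod.fst ⁻¹' {y} : Set (State S × M)) :=
    measurable_fst (measurableSet_singleton y)
  change (Measure.dirac (Sum.inl i, Classical.arbitrary M)).real _ = _
  rw [measureReal_def, Measure.dirac_apply' _ hm]
  by_cases h : y = Sum.inl i
  · simp [h]
  · simp [h, Ne.symm h]

theorem pow_transition_inl (i : Fin 2) (y : State S) (n : ℕ) :
    (transition D.absorbedKernel ^ n) (Sum.inl i) y = if y = Sum.inl i then 1 else 0 := by
  induction n with
  | zero => simp [Matrix.one_apply, eq_comm]
  | succ n ih => rw [pow_succ', Matrix.mul_apply]; simp [transition_absorbed_inl, ih]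

/-- Boundary states are never left, so a path between admissible states stays in `S` and only the
inner block contributes. -/
theorem pow_transition_inr (k l : S) (n : ℕ) :
    (transition D.absorbedKernel ^ n) (Sum.inr k) (Sum.inr l) = (D.inner ^ n) k l := by
  induction n generalizing l with
  | zero => simp [Matrix.one_apply]
  | succ n ih =>
    rw [pow_succ, pow_succ, Matrix.mul_apply, Matrix.mul_apply, Fintype.sum_sum_type]
    simp only [transition_absorbed_inl, ih]
    simp [transition, absorbedKernel, inner]

theorem inner_pow_nonneg (n : ℕ) (k l : S) : 0 ≤ (D.inner ^ n) k l := by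
  rw [← pow_transition_inr, ← law_chain]
  exact measureReal_nonneg

/-- Almost surely a boundary state once reached is kept, so being in `i` at time `n` agrees, up to a
null set, with having hit `i` by time `n`. Continuity from below gives the limit. -/
theorem tendsto_absorbed (k : S) (i : Fin 2) :
    Tendsto (fun n => (transition D.absorbedKernel ^ n) (Sum.inr k) (Sum.inl i)) atTop
      (𝓝 (D.absorptionProb k i)) := by
  have hstay : ∀ᵐ ω ∂(drawLaw D.absorbedKernel), ∀ n, (ω n (Sum.inl i)).1 = Sum.inl i := by
    rw [ae_all_iff]
    intro n
    have h : ∀ᵐ p ∂(D.absorbedKernel (Sum.inl i)), p.1 = Sum.inl i := by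
      have hm : MeasurableSet {p : State S × M | p.1 = Sum.inl i} :=
        measurable_fst (measurableSet_singleton _)
      exact (ae_dirac_iff hm).2 rfl
    rw [← map_draw_apply D.absorbedKernel n] at h
    exact ae_of_ae_map (f := fun ω : ℕ → State S → State S × M => ω n (Sum.inl i))
      (Measurable.aemeasurable (by fun_prop)) h
  have hlim := tendsto_measure_iUnion_accumulate (μ := drawLaw D.absorbedKernel)
    (f := fun n => {ω | chain (Sum.inr k) ω n = Sum.inl i})
  have hU : (⋃ n, {ω : ℕ → State S → State S × M | chain (Sum.inr k) ω n = Sum.inl i}) =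
      {ω | ∃ n, chain (Sum.inr k) ω n = Sum.inl i} := by ext; simp
  rw [hU] at hlim
  have hlim' := (ENNReal.tendsto_toReal (measure_ne_top _ _)).comp hlim
  refine hlim'.congr fun n => ?_
  rw [← law_chain, measureReal_def]
  refine congrArg ENNReal.toReal (measure_congr ?_)
  filter_upwards [hstay] with ω hω
  have hmono : ∀ m j, chain (Sum.inr k) ω m = Sum.inl i →
      chain (Sum.inr k) ω (m + j) = Sum.inl i := by
    intro m j hm
    induction j with
    | zero => exact hm
    | succ j ih => rw [← add_assoc, chain, ih, hω]
  change (ω ∈ Set.accumulate _ n) = (ω ∈ {ω | chain (Sum.inr k) ω n = Sum.inl i})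
  refine propext ⟨fun h => ?_, fun h => ?_⟩
  · obtain ⟨m, hm, h'⟩ := Set.mem_accumulate.1 h
    obtain ⟨j, rfl⟩ := Nat.exists_eq_add_of_le hm
    exact hmono m j h'
  · exact Set.mem_accumulate.2 ⟨n, le_rfl, h⟩

/-- First-step decomposition of the absorption probabilities. -/
theorem absorptionProb_eq (k : S) (i : Fin 2) :
    D.absorptionProb k i = D.exitProb k i + ∑ l, D.inner k l * D.absorptionProb l i := by
  refine tendsto_nhds_unique ((tendsto_absorbed D k i).comp (tendsto_add_atTop_nat 1)) ?_
  have : ∀ n, (transition D.absorbedKernel ^ (n + 1)) (Sum.inr k) (Sum.inl i) =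
      D.exitProb k i + ∑ l, D.inner k l *
        (transition D.absorbedKernel ^ n) (Sum.inr l) (Sum.inl i) := by
    intro n
    rw [pow_succ', Matrix.mul_apply, Fintype.sum_sum_type]
    simp [pow_transition_inl, transition, absorbedKernel, inner, exitProb]
  refine Tendsto.congr (fun n => (this n).symm) ?_
  exact tendsto_const_nhds.add
    (tendsto_finsetSum _ fun l _ => (tendsto_absorbed D l i).const_mul _)

variable {D} (hb : ∀ k, D.absorptionProb k 0 + D.absorptionProb k 1 = 1)
include hb

/-- The row sums of `D.inner ^ n` are the probabilities of not yet being absorbed; they tend to `1 -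
(b_{k0} + b_{k1}) = 0`. -/
theorem tendsto_inner_pow (k l : S) : Tendsto (fun n => (D.inner ^ n) k l) atTop (𝓝 0) := by
  have hsum : ∀ n, ∑ l, (D.inner ^ n) k l =
      1 - ((transition D.absorbedKernel ^ n) (Sum.inr k) (Sum.inl 0) +
        (transition D.absorbedKernel ^ n) (Sum.inr k) (Sum.inl 1)) := by
    intro n
    have h := sum_real_inter_chain (κ := D.absorbedKernel) (Sum.inr k) (n := n)
      (@MeasurableSet.univ _ (past (State S) M n))
    simp only [Set.univ_inter, law_chain, Fintype.sum_sum_type, Fin.sum_univ_two,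
      pow_transition_inr, probReal_univ] at h
    linarith
  have h0 : Tendsto (fun n => ∑ l, (D.inner ^ n) k l) atTop (𝓝 0) := by
    have h := ((tendsto_absorbed D k 0).add (tendsto_absorbed D k 1)).const_sub 1
    rw [hb, sub_self] at h
    exact h.congr fun n => (hsum n).symm
  exact squeeze_zero (fun n => inner_pow_nonneg D n k l) (fun n => Finset.single_le_sum
    (f := fun l => (D.inner ^ n) k l) (fun l _ => inner_pow_nonneg D n k l) (Finset.mem_univ l)) h0

/-- A vector in the kernel is fixed by every power of `D.inner`, and these powers tend to zero. -/
theorem isUnit_one_sub_inner : IsUnit (1 - D.inner) := by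
  rw [← Matrix.mulVec_injective_iff_isUnit]
  refine (injective_iff_map_eq_zero (Matrix.mulVecLin (1 - D.inner))).2 fun v hv => ?_
  have h1 : D.inner.mulVec v = v := by
    rw [Matrix.mulVecLin_apply, Matrix.sub_mulVec, Matrix.one_mulVec, sub_eq_zero] at hv
    exact hv.symm
  have hn : ∀ n, (D.inner ^ n).mulVec v = v := by
    intro n
    induction n with
    | zero => simp
    | succ n ih => rw [pow_succ, ← Matrix.mulVec_mulVec, h1, ih]
  funext k
  have h2 : Tendsto (fun n => (D.inner ^ n).mulVec v k) atTop (𝓝 (∑ l, 0 * v l)) :=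
    tendsto_finsetSum _ fun l _ => (tendsto_inner_pow hb k l).mul_const _
  simp only [hn, zero_mul, Finset.sum_const_zero] at h2
  exact tendsto_nhds_unique tendsto_const_nhds h2

/-- Neumann series: the inverse counts the expected visits to `l` before absorption. -/
theorem hasSum_inner_pow (k l : S) : HasSum (fun n => (D.inner ^ n) k l) ((1 - D.inner)⁻¹ k l) := by
  rw [hasSum_iff_tendsto_nat_of_nonneg (fun n => inner_pow_nonneg D n k l)]
  have hdet := (Matrix.isUnit_iff_isUnit_det _).1 (isUnit_one_sub_inner hb)
  have h : ∀ n, ∑ j ∈ Finset.range n, (D.inner ^ j) k l =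
      (1 - D.inner)⁻¹ k l - ∑ j, (1 - D.inner)⁻¹ k j * (D.inner ^ n) j l := by
    intro n
    rw [← Matrix.mul_apply, ← Matrix.sub_apply, ← Matrix.sum_apply,
      ← Matrix.nonsing_inv_mul_cancel_left _ (∑ j ∈ Finset.range n, D.inner ^ j) hdet,
      mul_neg_geom_sum, mul_sub, mul_one]
  simp_rw [h]
  have h2 : Tendsto (fun n => ∑ j, (1 - D.inner)⁻¹ k j * (D.inner ^ n) j l) atTop
      (𝓝 (∑ j, (1 - D.inner)⁻¹ k j * 0)) :=
    tendsto_finsetSum _ fun j _ => (tendsto_inner_pow hb j l).const_mul _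
  simpa using h2.const_sub ((1 - D.inner)⁻¹ k l)

theorem green_nonneg (k l : S) : 0 ≤ (1 - D.inner)⁻¹ k l :=
  (hasSum_inner_pow hb k l).nonneg fun n => inner_pow_nonneg D n k l

theorem green_mulVec_eq (ρ : S → ℝ) (k : S) :
    (1 - D.inner)⁻¹.mulVec ρ k =
      ρ k + ∑ l, D.inner k l * (1 - D.inner)⁻¹.mulVec ρ l := by
  have hdet := (Matrix.isUnit_iff_isUnit_det _).1 (isUnit_one_sub_inner hb)
  have h : (1 - D.inner).mulVec ((1 - D.inner)⁻¹.mulVec ρ) = ρ := by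
    rw [Matrix.mulVec_mulVec, Matrix.mul_nonsing_inv _ hdet, Matrix.one_mulVec]
  have h2 := congrFun h k
  rw [Matrix.sub_mulVec, Matrix.one_mulVec, Pi.sub_apply] at h2
  rw [sub_eq_iff_eq_add] at h2
  exact h2

/-- Mean total of a functional of the marks of the stays until absorption. -/
theorem integral_until_absorption {φ : M → ℝ}
    (hφ : ∀ k, Integrable (fun p => φ p.2) (D.stay k)) (k : S) :
    ∫ ω, ∑' n, (if (chain (Sum.inr k) ω n).isRight then φ (mark (Sum.inr k) ω n) else 0)
        ∂(drawLaw D.absorbedKernel) =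
      (1 - D.inner)⁻¹.mulVec (fun l => ∫ p, φ p.2 ∂(D.stay l)) k := by
  -- Stated for general `ψ` because it is used twice: with `|φ|` for absolute convergence and with
  -- `φ` for the value.
  have key : ∀ ψ : M → ℝ, (∀ k, Integrable (fun p => ψ p.2) (D.stay k)) → ∀ n,
      Integrable (fun ω => if (chain (Sum.inr k) ω n).isRight then
        ψ (mark (Sum.inr k) ω n) else 0) (drawLaw D.absorbedKernel) ∧
      ∫ ω, (if (chain (Sum.inr k) ω n).isRight then ψ (mark (Sum.inr k) ω n) else 0)
        ∂(drawLaw D.absorbedKernel) =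
      ∑ l, (D.inner ^ n) k l * ∫ p, ψ p.2 ∂(D.stay l) := by
    intro ψ hψ n
    have hg : ∀ x : State S, Integrable (fun p : State S × M => if x.isRight then ψ p.2 else 0)
        (D.absorbedKernel x) := by
      rintro (i | l)
      · simp
      · simpa using (show Integrable (fun p => ψ p.2) (D.absorbedKernel (Sum.inr l)) from hψ l)
    have h1 := integrable_outcome (g := fun x p => if x.isRight then ψ p.2 else 0)
      (Sum.inr k) hg n
    have h2 := setIntegral_outcome (g := fun x p => if x.isRight then ψ p.2 else 0)
      (Sum.inr k) hg (@MeasurableSet.univ _ (past (State S) M n))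
    refine ⟨h1, ?_⟩
    simp only [Set.univ_inter, law_chain, Fintype.sum_sum_type, pow_transition_inr,
      Measure.restrict_univ, Sum.isRight_inl, Sum.isRight_inr, if_true] at h2
    simp only [Bool.false_eq_true, if_false, integral_zero, mul_zero, Finset.sum_const_zero,
      zero_add] at h2
    exact h2
  have hs : ∀ v : S → ℝ, HasSum (fun n => ∑ l, (D.inner ^ n) k l * v l)
      ((1 - D.inner)⁻¹.mulVec v k) := fun v =>
    hasSum_sum fun l _ => (hasSum_inner_pow hb k l).mul_right (v l)
  have h := hasSum_integral_of_summable_integral_norm (fun n => (key φ hφ n).1) (by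
    have := (hs (fun l => ∫ p, |φ p.2| ∂(D.stay l))).summable
    refine this.congr fun n => ?_
    rw [← (key (fun m => |φ m|) (fun k => (hφ k).abs) n).2]
    refine integral_congr_ae (ae_of_all _ fun ω => ?_)
    simp only [Real.norm_eq_abs]
    split_ifs <;> simp)
  simp only [fun n => (key φ hφ n).2] at h
  exact h.unique (hs _)

end

end Model

/-! ### The Poisson equation of the controlled process -/

namespace Model

variable {S M : Type*} [Fintype S] [MeasurableSpace S] [MeasurableSingletonClass S]
  [MeasurableSpace M] (D : Model S M) (α : Fin 2 → stdSimplex ℝ S)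

section

variable {D} {f : State S × M → ℝ} {i : Fin 2}

theorem integrable_controlled (hf : ∀ k, Integrable (fun m => f (Sum.inr k, m)) (D.control i k)) :
    Integrable f (D.controlledKernel α (Sum.inl i)) := by
  refine integrable_finsetSum_measure.2 fun k _ => ?_
  refine Integrable.smul_measure ?_ ENNReal.ofReal_ne_top
  exact (measurableEmbedding_prodMk_left (Sum.inr k)).integrable_map_iff.2 (hf k)

theorem integral_controlled (hf : ∀ k, Integrable (fun m => f (Sum.inr k, m)) (D.control i k)) :
    ∫ p, f p ∂(D.controlledKernel α (Sum.inl i)) =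
      ∑ k, (α i).1 k * ∫ m, f (Sum.inr k, m) ∂(D.control i k) := by
  have h : ∀ k, Integrable f (ENNReal.ofReal ((α i).1 k) •
      (D.control i k).map (fun m => ((Sum.inr k : State S), m))) := fun k =>
    ((measurableEmbedding_prodMk_left (Sum.inr k)).integrable_map_iff.2 (hf k)).smul_measure
      ENNReal.ofReal_ne_top
  rw [controlledKernel, integral_finsetSum_measure fun k _ => h k]
  refine Finset.sum_congr rfl fun k _ => ?_
  rw [integral_smul_measure, (measurableEmbedding_prodMk_left (Sum.inr k)).integral_map,
    ENNReal.toReal_ofReal ((α i).2.1 k), smul_eq_mul]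

theorem integral_next_stay (h : State S → ℝ) (k : S) :
    ∫ p, h p.1 ∂(D.stay k) =
      (D.exitProb k 0 * h (Sum.inl 0) + D.exitProb k 1 * h (Sum.inl 1)) +
        ∑ l, D.inner k l * h (Sum.inr l) := by
  have := D.stay_prob
  have hs := integral_next (κ := fun _ : State S => D.stay k) h (Sum.inr k)
  rw [Fintype.sum_sum_type, Fin.sum_univ_two] at hs
  exact hs

end

variable [Nonempty M] [DecidableEq S]

/-- Up to a constant factor, the stationary mean of the one-stay reward `ρ`. -/
def balance (ρ : State S → ℝ) : ℝ :=
  (ρ (Sum.inl 0) + ∑ k, (α 0).1 k * (1 - D.inner)⁻¹.mulVec (fun l => ρ (Sum.inr l)) k) *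
      (∑ l, (α 1).1 l * D.absorptionProb l 0) +
    (ρ (Sum.inl 1) + ∑ k, (α 1).1 k * (1 - D.inner)⁻¹.mulVec (fun l => ρ (Sum.inr l)) k) *
      (∑ l, (α 0).1 l * D.absorptionProb l 1)

/-- Linearity lets a reward be balanced by subtracting `c * σ`, with `c` the quotient of the two
balances. -/
theorem balance_sub_mul (ρ σ : State S → ℝ) (c : ℝ) :
    D.balance α (fun x => ρ x - c * σ x) = D.balance α ρ - c * D.balance α σ := by
  have h : (fun l => ρ (Sum.inr l) - c * σ (Sum.inr l)) =
      (fun l => ρ (Sum.inr l)) - c • (fun l : S => σ (Sum.inr l)) := by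
    ext; simp
  simp only [balance, h, Matrix.mulVec_sub, Matrix.mulVec_smul, Pi.sub_apply, Pi.smul_apply,
    smul_eq_mul, mul_sub, Finset.sum_sub_distrib]
  simp only [mul_left_comm _ c, ← Finset.mul_sum]
  ring

theorem continuous_balance : Continuous (D.balance α) := by
  unfold balance Matrix.mulVec dotProduct
  fun_prop

variable {D} (hb₀ : ∀ k, 0 < D.absorptionProb k 0) (hb₁ : ∀ k, 0 < D.absorptionProb k 1)
  (hb : ∀ k, D.absorptionProb k 0 + D.absorptionProb k 1 = 1)

omit [MeasurableSingletonClass S] [DecidableEq S] in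
theorem sum_simplex_mul_pos (p : stdSimplex ℝ S) {v : S → ℝ} (hv : ∀ k, 0 < v k) :
    0 < ∑ k, p.1 k * v k := by
  refine lt_of_le_of_ne (Finset.sum_nonneg fun k _ => mul_nonneg (p.2.1 k) (hv k).le) fun h => ?_
  have h0 := (Finset.sum_eq_zero_iff_of_nonneg
    (fun k _ => mul_nonneg (p.2.1 k) (hv k).le)).1 h.symm
  have h1 := p.2.2
  rw [Finset.sum_eq_zero fun k hk => (mul_eq_zero.1 (h0 k hk)).resolve_right (hv k).ne'] at h1
  exact zero_ne_one h1

include hb₀ hb₁ hb in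
theorem balance_one_pos : 0 < D.balance α (fun _ => 1) := by
  have hG : ∀ k, 0 ≤ (1 - D.inner)⁻¹.mulVec (fun _ => (1 : ℝ)) k := fun k =>
    Finset.sum_nonneg fun l _ => mul_nonneg (green_nonneg hb k l) zero_le_one
  have hs : ∀ i, 0 ≤ ∑ k, (α i).1 k * (1 - D.inner)⁻¹.mulVec (fun _ => (1 : ℝ)) k := fun i =>
    Finset.sum_nonneg fun k _ => mul_nonneg ((α i).2.1 k) (hG k)
  have h0 := hs 0
  have h1 := hs 1
  have h2 := sum_simplex_mul_pos (α 1) hb₀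
  have h3 := sum_simplex_mul_pos (α 0) hb₁
  unfold balance
  positivity

include hb₁ hb in
/-- The Poisson equation has a solution if the reward is balanced. -/
theorem exists_poisson {ρ : State S → ℝ} (hρ : D.balance α ρ = 0) :
    ∃ h : State S → ℝ, ∀ x, ρ x + ∫ p, h p.1 ∂(D.controlledKernel α x) = h x := by
  set u := (1 - D.inner)⁻¹.mulVec (fun l => ρ (Sum.inr l)) with hu
  have huk : ∀ k, u k = ρ (Sum.inr k) + ∑ l, D.inner k l * u l := green_mulVec_eq hb _
  have hβ := sum_simplex_mul_pos (α 0) hb₁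
  -- The solution is normalised to vanish at boundary state 1. In `S` it must then be `u k + b_{k0}
  -- * h₀`, and the equation at boundary state 0 forces this value of `h₀`. The equation at boundary
  -- state 1 is what remains, and it is the balance condition.
  set h₀ := (ρ (Sum.inl 0) + ∑ k, (α 0).1 k * u k) /
    (∑ l, (α 0).1 l * D.absorptionProb l 1) with hh₀
  have hA : ρ (Sum.inl 0) + ∑ k, (α 0).1 k * u k =
      h₀ * (∑ l, (α 0).1 l * D.absorptionProb l 1) := by
    rw [hh₀, div_mul_cancel₀ _ hβ.ne']
  have hβ' : ∑ l, (α 0).1 l * D.absorptionProb l 0 =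
      1 - ∑ l, (α 0).1 l * D.absorptionProb l 1 := by
    rw [eq_sub_iff_add_eq, ← Finset.sum_add_distrib]
    simp only [← mul_add, hb, mul_one]
    exact (α 0).2.2
  let h : State S → ℝ := Sum.elim ![h₀, 0] (fun k => u k + D.absorptionProb k 0 * h₀)
  have hctrl : ∀ i, ∫ p, h p.1 ∂(D.controlledKernel α (Sum.inl i)) =
      (∑ k, (α i).1 k * u k) + (∑ k, (α i).1 k * D.absorptionProb k 0) * h₀ := by
    intro i
    have := D.control_prob i
    rw [integral_controlled α fun k => integrable_const _]
    simp only [h, Sum.elim_inr, integral_const, probReal_univ, one_smul]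
    simp only [mul_add, Finset.sum_add_distrib, Finset.sum_mul, mul_assoc]
  refine ⟨h, ?_⟩
  rintro (i | k)
  · rw [hctrl]
    fin_cases i
    · change ρ (Sum.inl 0) + ((∑ k, (α 0).1 k * u k) +
        (∑ k, (α 0).1 k * D.absorptionProb k 0) * h₀) = h₀
      rw [hβ']
      linear_combination hA
    · change ρ (Sum.inl 1) + ((∑ k, (α 1).1 k * u k) +
        (∑ k, (α 1).1 k * D.absorptionProb k 0) * h₀) = 0
      rw [balance, hA] at hρ
      refine mul_right_cancel₀ hβ.ne' ?_
      linear_combination hρ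
  · change _ + ∫ p, h p.1 ∂(D.stay k) = u k + D.absorptionProb k 0 * h₀
    rw [integral_next_stay, absorptionProb_eq, huk k]
    simp only [h, Sum.elim_inr, Sum.elim_inl, Matrix.cons_val_zero, Matrix.cons_val_one, mul_add,
      Finset.sum_add_distrib, add_mul, Finset.sum_mul, mul_assoc, mul_zero]
    ring

end Model

/-! ### Sums over the stays begun by a given time -/

section Deterministic

variable {T τ : ℕ → ℝ} {t : ℝ}

theorem abs_sum_increments_le (hT : Monotone T) {f : ℕ → ℝ} {H : ℝ} (hf : ∀ n, |f n| ≤ H) (m : ℕ) :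
    |∑ n ∈ Finset.range m, if T n ≤ t then f (n + 1) - f n else 0| ≤ 2 * H := by
  have hd : ∀ n, |f n - f 0| ≤ 2 * H := fun n => by
    have := abs_sub (f n) (f 0)
    linarith [hf n, hf 0]
  -- By monotonicity the begun stays form an initial segment, so the sum telescopes; `j` is the
  -- number of begun stays among the first `m`.
  have key : ∀ m, ∃ j, (T m ≤ t → j = m) ∧
      ∑ n ∈ Finset.range m, (if T n ≤ t then f (n + 1) - f n else 0) = f j - f 0 := by
    intro m
    induction m with
    | zero => exact ⟨0, by simp⟩
    | succ m ih =>
      obtain ⟨j, hj, hs⟩ := ih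
      rw [Finset.sum_range_succ, hs]
      by_cases hm : T m ≤ t
      · exact ⟨m + 1, fun _ => rfl, by rw [if_pos hm, hj hm]; ring⟩
      · exact ⟨j, fun h => absurd ((hT m.le_succ).trans h) hm, by rw [if_neg hm, add_zero]⟩
  obtain ⟨j, -, hs⟩ := key m
  rw [hs]
  exact hd j

/-- At most one stay is in progress at time `t`. -/
theorem sum_in_progress_le (hT : Monotone T) (m : ℕ) :
    ∑ n ∈ Finset.range m, (if T n ≤ t ∧ t < T (n + 1) then (1 : ℝ) else 0) ≤ 1 := by
  have h : ∀ n, (if T n ≤ t ∧ t < T (n + 1) then (1 : ℝ) else 0) =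
      (if T n ≤ t then 1 else 0) - (if T (n + 1) ≤ t then 1 else 0) := by
    intro n
    have := hT n.le_succ
    by_cases h1 : T n ≤ t <;> by_cases h2 : T (n + 1) ≤ t
    · simp [h1, h2]
    · simp [h1, h2, not_le.1 h2]
    · exact absurd (this.trans h2) h1
    · simp [h1, h2]
  simp_rw [h]
  rw [Finset.sum_range_sub' (fun n => if T n ≤ t then (1 : ℝ) else 0)]
  split_ifs <;> norm_num

/-- The elapsed parts of the stays begun by time `t` add up to `t`. -/
theorem sum_elapsed (h0 : T 0 = 0) (hτ : ∀ n, T (n + 1) = T n + τ n) (hnn : ∀ n, 0 ≤ τ n)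
    (ht : 0 ≤ t) (m : ℕ) :
    ∑ n ∈ Finset.range m, (if T n ≤ t then min (t - T n) (τ n) else 0) = min t (T m) := by
  induction m with
  | zero => simp [h0, ht]
  | succ m ih =>
    rw [Finset.sum_range_succ, ih, hτ]
    have := hnn m
    split_ifs with h
    · rw [min_eq_right h, ← min_add_add_left, add_sub_cancel]
    · rw [min_eq_left (not_le.1 h).le, min_eq_left (by linarith [not_le.1 h]), add_zero]

/-- Completed stays are covered by their elapsed times, and the truncation limits the overshoot of
the stay in progress to `K`. -/
theorem sum_truncated_le (h0 : T 0 = 0) (hτ : ∀ n, T (n + 1) = T n + τ n) (hnn : ∀ n, 0 ≤ τ n)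
    (ht : 0 ≤ t) {K : ℝ} (hK : 0 ≤ K) (m : ℕ) :
    ∑ n ∈ Finset.range m, (if T n ≤ t then min (τ n) K else 0) ≤ t + K := by
  have hT : Monotone T := monotone_nat_of_le_succ fun n => by linarith [hτ n, hnn n]
  have h1 := sum_elapsed h0 hτ hnn ht m
  have h2 := sum_in_progress_le (t := t) hT m
  calc _ ≤ ∑ n ∈ Finset.range m, ((if T n ≤ t then min (t - T n) (τ n) else 0) +
        K * (if T n ≤ t ∧ t < T (n + 1) then (1 : ℝ) else 0)) := by
        refine Finset.sum_le_sum fun n _ => ?_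
        by_cases h : T n ≤ t
        · by_cases h' : t < T (n + 1)
          · rw [if_pos h, if_pos h, if_pos ⟨h, h'⟩, mul_one]
            have : 0 ≤ min (t - T n) (τ n) := le_min (by linarith) (hnn n)
            linarith [min_le_right (τ n) K]
          · rw [if_pos h, if_pos h, if_neg fun hh => h' hh.2, mul_zero, add_zero,
              min_eq_right (a := t - T n) (by linarith [hτ n])]
            exact min_le_left _ _
        · simp [h]
    _ = min t (T m) + K * _ := by rw [Finset.sum_add_distrib, h1, Finset.mul_sum]
    _ ≤ t + K := by
        have := mul_le_mul_of_nonneg_left h2 hK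
        linarith [min_le_left t (T m)]

/-- Replacing the complete rewards of the stays by the rewards obtained up to time `t` matters
only for the stay in progress at time `t`. -/
theorem abs_interrupted_sub_le (h0 : T 0 = 0) (hτ : ∀ n, T (n + 1) = T n + τ n)
    (hnn : ∀ n, 0 ≤ τ n) (ht : 0 ≤ t) {r : ℕ → ℝ → ℝ} {b f : ℕ → ℝ} {H g K : ℝ}
    (hr : ∀ n u, 0 ≤ u → u ≤ τ n → |r n u| ≤ b n) (hf : ∀ n, |f n| ≤ H) (hK : 0 ≤ K) (m : ℕ) :
    |(∑ n ∈ Finset.range m, if T n ≤ t then r n (min (t - T n) (τ n)) else 0) - g * min t (T m) -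
      ∑ n ∈ Finset.range m, (if T n ≤ t then r n (τ n) - g * τ n + f (n + 1) - f n else 0)| ≤
    2 * H + K +
      ∑ n ∈ Finset.range m, if T n ≤ t then max (2 * b n + |g| * τ n - K) 0 else 0 := by
  have hT : Monotone T := monotone_nat_of_le_succ fun n => by linarith [hτ n, hnn n]
  have h1 := abs_sum_increments_le (t := t) hT hf m
  have h2 := sum_in_progress_le (t := t) hT m
  -- Only the stay in progress contributes, with error at most `2 * b n + |g| * τ n`. The part up to
  -- `K` is paid once. The excess over `K` is charged to every begun stay, since being begun is a
  -- past event while being in progress is not.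
  have h3 : |∑ n ∈ Finset.range m, (if T n ≤ t then
      (r n (min (t - T n) (τ n)) - g * min (t - T n) (τ n)) - (r n (τ n) - g * τ n) else 0)| ≤
      ∑ n ∈ Finset.range m, (K * (if T n ≤ t ∧ t < T (n + 1) then (1 : ℝ) else 0) +
        if T n ≤ t then max (2 * b n + |g| * τ n - K) 0 else 0) := by
    refine (Finset.abs_sum_le_sum_abs _ _).trans (Finset.sum_le_sum fun n _ => ?_)
    by_cases h : T n ≤ t
    · by_cases h' : t < T (n + 1)
      · rw [if_pos h, if_pos h, if_pos ⟨h, h'⟩, mul_one,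
          min_eq_left (a := t - T n) (by linarith [hτ n])]
        have e1 := hr n (t - T n) (by linarith) (by linarith [hτ n])
        have e2 := hr n (τ n) (hnn n) le_rfl
        have e3 : |g * (τ n - (t - T n))| ≤ |g| * τ n := by
          rw [abs_mul, abs_of_nonneg (by linarith [hτ n] : 0 ≤ τ n - (t - T n))]
          exact mul_le_mul_of_nonneg_left (by linarith) (abs_nonneg g)
        have e4 := le_max_left (2 * b n + |g| * τ n - K) 0
        rw [abs_le] at e1 e2 e3 ⊢
        constructor <;> linarith
      · rw [if_pos h, if_pos h, if_neg fun hh => h' hh.2,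
          min_eq_right (a := t - T n) (by linarith [hτ n])]
        simp
    · simp [h]
  rw [Finset.sum_add_distrib, ← Finset.mul_sum] at h3
  have h4 : (∑ n ∈ Finset.range m, if T n ≤ t then r n (min (t - T n) (τ n)) else 0) -
      g * min t (T m) -
      ∑ n ∈ Finset.range m, (if T n ≤ t then r n (τ n) - g * τ n + f (n + 1) - f n else 0) =
      (∑ n ∈ Finset.range m, (if T n ≤ t then
      (r n (min (t - T n) (τ n)) - g * min (t - T n) (τ n)) - (r n (τ n) - g * τ n) else 0)) -
      ∑ n ∈ Finset.range m, if T n ≤ t then f (n + 1) - f n else 0 := by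
    rw [← sum_elapsed h0 hτ hnn ht m, Finset.mul_sum, ← Finset.sum_sub_distrib,
      ← Finset.sum_sub_distrib, ← Finset.sum_sub_distrib]
    refine Finset.sum_congr rfl fun n _ => ?_
    split_ifs <;> ring
  rw [h4]
  have h5 := mul_le_mul_of_nonneg_left h2 hK
  refine (abs_sub _ _).trans ?_
  linarith

end Deterministic

/-- A series of functions that converges absolutely in mean has an integrable sum. -/
theorem integrable_tsum_of_summable {Ω : Type*} [MeasurableSpace Ω] {μ : Measure Ω}
    {F : ℕ → Ω → ℝ} (hF : ∀ n, Integrable (F n) μ) (hs : Summable fun n => ∫ ω, ‖F n ω‖ ∂μ) :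
    Integrable (fun ω => ∑' n, F n ω) μ := by
  have hn : ∑' n, ‖(hF n).toL1 (F n)‖ₑ ≠ ⊤ := by
    have : ∀ n, ‖(hF n).toL1 (F n)‖ₑ = ENNReal.ofReal (∫ ω, ‖F n ω‖ ∂μ) := fun n => by
      rw [Integrable.enorm_toL1, ofReal_integral_norm_eq_lintegral_enorm (hF n)]
    simp_rw [this]
    exact hs.tsum_ofReal_ne_top
  have h := Lp.coeFn_tsum hn
  have h2 : ∀ᵐ ω ∂μ, ∀ n, (hF n).toL1 (F n) ω = F n ω :=
    ae_all_iff.2 fun n => (hF n).coeFn_toL1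
  refine (L1.integrable_coeFn (∑' n, (hF n).toL1 (F n))).congr ?_
  filter_upwards [h, h2] with ω h h2
  rw [h]
  exact tsum_congr h2

namespace Model

variable {S M : Type*} [Fintype S] [MeasurableSpace S] [MeasurableSingletonClass S]
  [MeasurableSpace M] (D : Model S M) (x₀ : State S)

theorem jumpTime_succ (ω : ℕ → State S → State S × M) (n : ℕ) :
    D.jumpTime x₀ ω (n + 1) = D.jumpTime x₀ ω n + D.dur (mark x₀ ω n) :=
  Finset.sum_range_succ _ _

theorem jumpTime_monotone (ω : ℕ → State S → State S × M) : Monotone (D.jumpTime x₀ ω) :=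
  monotone_nat_of_le_succ fun n => by
    rw [jumpTime_succ]; linarith [D.dur_nonneg (mark x₀ ω n)]

theorem measurable_jumpTime_past (n : ℕ) :
    Measurable[past (State S) M n] (fun ω => D.jumpTime x₀ ω n) := by
  refine @Finset.measurable_sum _ _ _ _ _ _ (past (State S) M n) _ _ fun j hj => ?_
  exact D.dur_measurable.comp (measurable_mark_past x₀ (Finset.mem_range.1 hj))

theorem measurable_jumpTime (n : ℕ) :
    Measurable (fun ω : ℕ → State S → State S × M => D.jumpTime x₀ ω n) :=
  (D.measurable_jumpTime_past x₀ n).mono (past_le n) le_rfl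

theorem measurableSet_begun_past (t : ℝ) (n : ℕ) :
    MeasurableSet[past (State S) M n] {ω | D.jumpTime x₀ ω n ≤ t} :=
  D.measurable_jumpTime_past x₀ n measurableSet_Iic

theorem measurableSet_begun (t : ℝ) (n : ℕ) :
    MeasurableSet {ω : ℕ → State S → State S × M | D.jumpTime x₀ ω n ≤ t} :=
  past_le n _ (D.measurableSet_begun_past x₀ t n)

variable {D x₀} {μ : Measure (ℕ → State S → State S × M)}
  {F : ℕ → (ℕ → State S → State S × M) → ℝ}

theorem integrable_begun (hF : ∀ n, Integrable (F n) μ) (t : ℝ) (n : ℕ) :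
    Integrable (fun ω => if D.jumpTime x₀ ω n ≤ t then F n ω else 0) μ :=
  (hF n).indicator (D.measurableSet_begun x₀ t n)

theorem integral_begun (t : ℝ) (n : ℕ) :
    ∫ ω, (if D.jumpTime x₀ ω n ≤ t then F n ω else 0) ∂μ =
      ∫ ω in {ω | D.jumpTime x₀ ω n ≤ t}, F n ω ∂μ :=
  integral_indicator (D.measurableSet_begun x₀ t n)

theorem integral_sum_begun (hF : ∀ n, Integrable (F n) μ) (t : ℝ) (m : ℕ) :
    ∫ ω, ∑ n ∈ Finset.range m, (if D.jumpTime x₀ ω n ≤ t then F n ω else 0) ∂μ =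
      ∑ n ∈ Finset.range m, ∫ ω in {ω | D.jumpTime x₀ ω n ≤ t}, F n ω ∂μ := by
  rw [integral_finsetSum _ fun n _ => integrable_begun hF t n]
  exact Finset.sum_congr rfl fun n _ => integral_begun t n

end Model

/-! ### The controlled process in the long run -/

namespace Model

variable {S M : Type*} [Fintype S] [MeasurableSpace S] [MeasurableSingletonClass S]
  [MeasurableSpace M] {D : Model S M} {α : Fin 2 → stdSimplex ℝ S} (x₀ : State S)

theorem integrable_mark_kernel {φ : M → ℝ} (hs : ∀ k, Integrable (fun p => φ p.2) (D.stay k))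
    (hc : ∀ i k, Integrable φ (D.control i k)) (x : State S) :
    Integrable (fun p => φ p.2) (D.controlledKernel α x) := by
  rcases x with i | k
  · exact integrable_controlled α fun k => hc i k
  · exact hs k

theorem exists_abs_le (f : State S → ℝ) : ∃ H, 0 ≤ H ∧ ∀ x, |f x| ≤ H :=
  ⟨∑ x, |f x|, Finset.sum_nonneg fun _ _ => abs_nonneg _, fun x =>
    Finset.single_le_sum (f := fun x => |f x|) (fun _ _ => abs_nonneg _) (Finset.mem_univ x)⟩

theorem integrable_dur (x : State S) :
    Integrable (fun p => D.dur p.2) (D.controlledKernel α x) :=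
  integrable_mark_kernel D.dur_integrable_stay D.dur_integrable_control x

theorem integrable_income (x : State S) :
    Integrable (fun p => D.income p.2 (D.dur p.2)) (D.controlledKernel α x) := by
  obtain ⟨B, hB, hBs, hBc⟩ := D.income_dominated
  refine (integrable_mark_kernel hBs hBc x).mono' ?_
    (ae_of_all _ fun p => hB p.2 _ (D.dur_nonneg _) le_rfl)
  exact (D.income_measurable.comp (measurable_snd.prodMk
    (D.dur_measurable.comp measurable_snd))).aestronglyMeasurable

/-- The mean number of stays begun by time `t` grows at most linearly if truncated durations have a
positive drift. -/
theorem exists_renewal_bound {c K : ℝ} (hc : 0 < c) (hK : 0 ≤ K) (f : State S → ℝ)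
    (hdrift : ∀ x, c + f x ≤ ∫ p, (min (D.dur p.2) K + f p.1) ∂(D.controlledKernel α x)) :
    ∃ C, 0 ≤ C ∧ ∀ t, 0 ≤ t → ∀ m, ∑ n ∈ Finset.range m,
      (drawLaw (D.controlledKernel α)).real {ω | D.jumpTime x₀ ω n ≤ t} ≤ C * (1 + t) := by
  obtain ⟨H, hH, hf⟩ := exists_abs_le f
  refine ⟨(1 + K + 2 * H) / c, by positivity, fun t ht m => ?_⟩
  -- Each begun stay adds at least `c` to the mean of the sum of `g`, while on every path this sum
  -- is at most `t + K + 2 * H`.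
  let g : State S → State S × M → ℝ := fun x p => min (D.dur p.2) K + f p.1 - f x
  have hmin : ∀ x, Integrable (fun p : State S × M => min (D.dur p.2) K)
      (D.controlledKernel α x) := fun x => (integrable_dur x).inf (integrable_const K)
  have hg : ∀ x, Integrable (g x) (D.controlledKernel α x) := fun x =>
    ((hmin x).add (integrable_next f x)).sub (integrable_const _)
  have hgc : ∀ x, c ≤ ∫ p, g x p ∂(D.controlledKernel α x) := fun x => by
    have hi : Integrable (fun p : State S × M => min (D.dur p.2) K + f p.1)
        (D.controlledKernel α x) := (hmin x).add (integrable_next f x)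
    rw [integral_sub hi (integrable_const _)]
    simp only [integral_const, probReal_univ, one_smul]
    linarith [hdrift x]
  have h1 : c * ∑ n ∈ Finset.range m,
      (drawLaw (D.controlledKernel α)).real {ω | D.jumpTime x₀ ω n ≤ t} ≤
      ∑ n ∈ Finset.range m, ∫ ω in {ω | D.jumpTime x₀ ω n ≤ t},
        g (chain x₀ ω n) (ω n (chain x₀ ω n)) ∂(drawLaw (D.controlledKernel α)) := by
    rw [Finset.mul_sum]
    exact Finset.sum_le_sum fun n _ =>
      le_setIntegral_outcome x₀ hg hgc (D.measurableSet_begun_past x₀ t n)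
  have hint := fun n => integrable_outcome x₀ hg n
  rw [← integral_sum_begun hint] at h1
  have h2 : ∫ ω, ∑ n ∈ Finset.range m, (if D.jumpTime x₀ ω n ≤ t then
      g (chain x₀ ω n) (ω n (chain x₀ ω n)) else 0) ∂(drawLaw (D.controlledKernel α)) ≤
      ∫ ω, (t + K + 2 * H) ∂(drawLaw (D.controlledKernel α)) := by
    refine integral_mono (integrable_finsetSum _ fun n _ => integrable_begun hint t n)
      (integrable_const _) fun ω => ?_
    have e1 := sum_truncated_le (T := D.jumpTime x₀ ω) (by simp [jumpTime])
      (D.jumpTime_succ x₀ ω) (fun n => D.dur_nonneg _) ht hK m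
    have e2 := (le_abs_self _).trans (abs_sum_increments_le (t := t) (D.jumpTime_monotone x₀ ω)
      (fun n => hf (chain x₀ ω n)) m)
    refine le_trans (le_of_eq ?_) (add_le_add e1 e2)
    rw [← Finset.sum_add_distrib]
    refine Finset.sum_congr rfl fun n _ => ?_
    split_ifs
    · exact add_sub_assoc _ _ _
    · simp
  rw [integral_const, probReal_univ, one_smul] at h2
  rw [div_mul_eq_mul_div, le_div_iff₀ hc]
  nlinarith [mul_nonneg (by positivity : 0 ≤ K + 2 * H) ht]

section LongRun

variable {C : ℝ} (hC : ∀ t, 0 ≤ t → ∀ m, ∑ n ∈ Finset.range m,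
  (drawLaw (D.controlledKernel α)).real {ω | D.jumpTime x₀ ω n ≤ t} ≤ C * (1 + t))
include hC

theorem summable_begun (t : ℝ) :
    Summable fun n => (drawLaw (D.controlledKernel α)).real {ω | D.jumpTime x₀ ω n ≤ t} := by
  -- The bound `hC` covers only nonnegative times; a negative `t` is compared with time `0`.
  have h : Summable fun n =>
      (drawLaw (D.controlledKernel α)).real {ω | D.jumpTime x₀ ω n ≤ max t 0} :=
    summable_of_sum_range_le (fun n => measureReal_nonneg) (hC _ (le_max_right t 0))
  exact h.of_nonneg_of_le (fun n => measureReal_nonneg) fun n =>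
    measureReal_mono fun ω hω => le_trans hω (le_max_left t 0)

/-- Borel–Cantelli at each integer level: only finitely many stays begin by time `j`. -/
theorem ae_tendsto_jumpTime :
    ∀ᵐ ω ∂(drawLaw (D.controlledKernel α)), Tendsto (fun n => D.jumpTime x₀ ω n) atTop atTop := by
  have h : ∀ j : ℕ, ∀ᵐ ω ∂(drawLaw (D.controlledKernel α)),
      ∀ᶠ n in atTop, ω ∉ {ω | D.jumpTime x₀ ω n ≤ j} := fun j => by
    refine ae_eventually_notMem ?_
    have := (summable_begun x₀ hC j).tsum_ofReal_ne_top
    simpa using this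
  filter_upwards [ae_all_iff.2 h] with ω hω
  refine tendsto_atTop.2 fun b => ?_
  obtain ⟨j, hj⟩ := exists_nat_ge b
  filter_upwards [hω j] with n hn
  exact hj.trans (not_le.1 hn).le

variable (D) in
/-- Income obtained by time `t` during the `n`-th stay. -/
def stayIncome (t : ℝ) (n : ℕ) (ω : ℕ → State S → State S × M) : ℝ :=
  D.income (mark x₀ ω n) (min (t - D.jumpTime x₀ ω n) (D.dur (mark x₀ ω n)))

omit hC in
theorem measurable_stayIncome (t : ℝ) (n : ℕ) : Measurable (D.stayIncome x₀ t n) :=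
  D.income_measurable.comp ((measurable_mark x₀ n).prodMk
    ((measurable_const.sub (D.measurable_jumpTime x₀ n)).min
      (D.dur_measurable.comp (measurable_mark x₀ n))))

omit hC in
theorem integrable_begun_stayIncome (t : ℝ) (n : ℕ) :
    Integrable (fun ω => if D.jumpTime x₀ ω n ≤ t then D.stayIncome x₀ t n ω else 0)
      (drawLaw (D.controlledKernel α)) := by
  obtain ⟨B, hB, hBs, hBc⟩ := D.income_dominated
  have hBi := integrable_begun (D := D) (x₀ := x₀) (fun n => integrable_outcome
    (g := fun _ p => B p.2) x₀ (integrable_mark_kernel (α := α) hBs hBc) n) t n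
  refine hBi.mono' ((measurable_stayIncome x₀ t n).ite (D.measurableSet_begun x₀ t n)
    measurable_const).aestronglyMeasurable (ae_of_all _ fun ω => ?_)
  split_ifs with h
  · exact hB _ _ (le_min (sub_nonneg.2 h) (D.dur_nonneg _)) (min_le_right _ _)
  · simp

/-- The dominating mark function has one-stay means bounded over the finitely many states, so each
term is at most a constant times the probability that the stay has begun. -/
theorem summable_integral_norm_stayIncome (t : ℝ) :
    Summable fun n => ∫ ω, ‖if D.jumpTime x₀ ω n ≤ t then D.stayIncome x₀ t n ω else 0‖
      ∂(drawLaw (D.controlledKernel α)) := by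
  obtain ⟨B, hB, hBs, hBc⟩ := D.income_dominated
  have hBk := integrable_mark_kernel (α := α) hBs hBc
  obtain ⟨b, -, hb⟩ := exists_abs_le fun x => ∫ p, B p.2 ∂(D.controlledKernel α x)
  refine ((summable_begun x₀ hC t).mul_left b).of_nonneg_of_le
    (fun n => integral_nonneg fun ω => norm_nonneg _) fun n => ?_
  have hint := fun n => integrable_outcome (g := fun _ p => B p.2) x₀ hBk n
  refine le_trans ?_ (setIntegral_outcome_le (g := fun _ p => B p.2) x₀ hBk
    (fun x => (le_abs_self _).trans (hb x)) (D.measurableSet_begun_past x₀ t n))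
  rw [← integral_begun (F := fun n ω => B (ω n (chain x₀ ω n)).2)]
  refine integral_mono (integrable_begun_stayIncome x₀ t n).norm (integrable_begun hint t n)
    fun ω => ?_
  dsimp only
  split_ifs with h
  · exact hB _ _ (le_min (sub_nonneg.2 h) (D.dur_nonneg _)) (min_le_right _ _)
  · simp

theorem integrable_accumulated (t : ℝ) :
    Integrable (D.accumulated x₀ t) (drawLaw (D.controlledKernel α)) :=
  integrable_tsum_of_summable (integrable_begun_stayIncome x₀ t)
    (summable_integral_norm_stayIncome x₀ hC t)

theorem tendsto_integral_sum_stayIncome (t : ℝ) :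
    Tendsto (fun m => ∫ ω, ∑ n ∈ Finset.range m,
      (if D.jumpTime x₀ ω n ≤ t then D.stayIncome x₀ t n ω else 0)
        ∂(drawLaw (D.controlledKernel α))) atTop (𝓝 (D.V α x₀ t)) := by
  have h := (hasSum_integral_of_summable_integral_norm (integrable_begun_stayIncome x₀ t)
    (summable_integral_norm_stayIncome x₀ hC t)).tendsto_sum_nat
  refine h.congr fun m => ?_
  rw [integral_finsetSum _ fun n _ => integrable_begun_stayIncome x₀ t n]

theorem tendsto_integral_min_jumpTime {t : ℝ} (ht : 0 ≤ t) :
    Tendsto (fun m => ∫ ω, min t (D.jumpTime x₀ ω m) ∂(drawLaw (D.controlledKernel α)))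
      atTop (𝓝 t) := by
  have h : Tendsto (fun m => ∫ ω, min t (D.jumpTime x₀ ω m) ∂(drawLaw (D.controlledKernel α)))
      atTop (𝓝 (∫ ω, t ∂(drawLaw (D.controlledKernel α)))) := by
    refine tendsto_integral_of_dominated_convergence (fun _ => t)
      (fun m => (measurable_const.min (D.measurable_jumpTime x₀ m)).aestronglyMeasurable)
      (integrable_const t) (fun m => ae_of_all _ fun ω => ?_) ?_
    · have : 0 ≤ D.jumpTime x₀ ω m := Finset.sum_nonneg fun _ _ => D.dur_nonneg _
      rw [Real.norm_of_nonneg (le_min ht this)]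
      exact min_le_left _ _
    · filter_upwards [ae_tendsto_jumpTime x₀ hC] with ω hω
      refine tendsto_const_nhds.congr' ?_
      filter_upwards [hω.eventually_ge_atTop t] with m hm
      rw [min_eq_left hm]
  simpa using h

/-- If the one-stay reward `income - g * duration` is the boundary of a function `h`, the mean
income deviates from `g * t` only by the contribution of the interrupted stay. -/
theorem abs_V_sub_le {g : ℝ} {h : State S → ℝ} {H K ε : ℝ} {B : M → ℝ}
    (hpoisson : ∀ x, ∫ p, (D.income p.2 (D.dur p.2) - g * D.dur p.2 + h p.1 - h x)
      ∂(D.controlledKernel α x) = 0)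
    (hB : ∀ m u, 0 ≤ u → u ≤ D.dur m → |D.income m u| ≤ B m)
    (hBk : ∀ x, Integrable (fun p => B p.2) (D.controlledKernel α x))
    (hH : ∀ x, |h x| ≤ H) (hK : 0 ≤ K) (hε : 0 ≤ ε)
    (hKε : ∀ x, ∫ p, max (2 * B p.2 + |g| * D.dur p.2 - K) 0 ∂(D.controlledKernel α x) ≤ ε)
    {t : ℝ} (ht : 0 ≤ t) :
    |D.V α x₀ t - g * t| ≤ 2 * H + K + ε * (C * (1 + t)) := by
  have hlim := ((tendsto_integral_sum_stayIncome x₀ hC t).sub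
    ((tendsto_integral_min_jumpTime x₀ hC ht).const_mul g)).abs
  refine le_of_tendsto' hlim fun m => ?_
  let G : State S → State S × M → ℝ := fun x p =>
    D.income p.2 (D.dur p.2) - g * D.dur p.2 + h p.1 - h x
  let Z : State S → State S × M → ℝ := fun _ p => max (2 * B p.2 + |g| * D.dur p.2 - K) 0
  have hG : ∀ x, Integrable (G x) (D.controlledKernel α x) := fun x =>
    (((integrable_income x).sub ((integrable_dur x).const_mul g)).add (integrable_next h x)).sub
      (integrable_const _)
  have hZ : ∀ x, Integrable (Z x) (D.controlledKernel α x) := fun x =>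
    ((((hBk x).const_mul 2).add ((integrable_dur x).const_mul |g|)).sub (integrable_const K)).sup
      (integrable_const 0)
  have hGi := fun n => integrable_outcome x₀ hG n
  have hZi := fun n => integrable_outcome x₀ hZ n
  -- Optional stopping: `G` has mean zero from every state, and whether a stay has begun is known
  -- before its outcome is drawn.
  have hGsum : ∫ ω, ∑ n ∈ Finset.range m, (if D.jumpTime x₀ ω n ≤ t then
      G (chain x₀ ω n) (ω n (chain x₀ ω n)) else 0) ∂(drawLaw (D.controlledKernel α)) = 0 := by
    rw [integral_sum_begun hGi]
    refine Finset.sum_eq_zero fun n _ => ?_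
    rw [setIntegral_outcome x₀ hG (D.measurableSet_begun_past x₀ t n)]
    exact Finset.sum_eq_zero fun x _ => by rw [hpoisson x, mul_zero]
  have hZsum : ∫ ω, ∑ n ∈ Finset.range m, (if D.jumpTime x₀ ω n ≤ t then
      Z (chain x₀ ω n) (ω n (chain x₀ ω n)) else 0) ∂(drawLaw (D.controlledKernel α)) ≤
      ε * (C * (1 + t)) := by
    rw [integral_sum_begun hZi]
    refine le_trans (Finset.sum_le_sum fun n _ => setIntegral_outcome_le x₀ hZ hKε
      (D.measurableSet_begun_past x₀ t n)) ?_
    rw [← Finset.mul_sum]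
    exact mul_le_mul_of_nonneg_left (hC t ht m) hε
  have hI1 : Integrable (fun ω => ∑ n ∈ Finset.range m,
      (if D.jumpTime x₀ ω n ≤ t then D.stayIncome x₀ t n ω else 0))
      (drawLaw (D.controlledKernel α)) :=
    integrable_finsetSum _ fun n _ => integrable_begun_stayIncome x₀ t n
  have hI2 : Integrable (fun ω => g * min t (D.jumpTime x₀ ω m))
      (drawLaw (D.controlledKernel α)) := by
    refine Integrable.const_mul ((integrable_const t).mono'
      (measurable_const.min (D.measurable_jumpTime x₀ m)).aestronglyMeasurable
      (ae_of_all _ fun ω => ?_)) g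
    have : 0 ≤ D.jumpTime x₀ ω m := Finset.sum_nonneg fun _ _ => D.dur_nonneg _
    rw [Real.norm_of_nonneg (le_min ht this)]
    exact min_le_left _ _
  have hI3 := integrable_finsetSum (Finset.range m) fun n _ =>
    integrable_begun (D := D) (x₀ := x₀) hGi t n
  have hI4 := integrable_finsetSum (Finset.range m) fun n _ =>
    integrable_begun (D := D) (x₀ := x₀) hZi t n
  have hI12 : Integrable (fun ω => (∑ n ∈ Finset.range m,
      (if D.jumpTime x₀ ω n ≤ t then D.stayIncome x₀ t n ω else 0)) -
      g * min t (D.jumpTime x₀ ω m)) (drawLaw (D.controlledKernel α)) := hI1.sub hI2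
  have hcentred := integral_sub hI12 hI3
  rw [hGsum, sub_zero] at hcentred
  rw [← integral_const_mul, ← integral_sub hI1 hI2, ← hcentred]
  refine abs_integral_le_integral_abs.trans ?_
  refine (integral_mono (hI12.sub hI3).abs ((integrable_const (2 * H + K)).add hI4)
    fun ω => ?_).trans ?_
  · exact abs_interrupted_sub_le (T := D.jumpTime x₀ ω) (by simp [jumpTime])
      (D.jumpTime_succ x₀ ω) (fun n => D.dur_nonneg _) ht
      (r := fun n u => D.income (mark x₀ ω n) u) (b := fun n => B (mark x₀ ω n))
      (f := fun n => h (chain x₀ ω n)) (fun n u => hB _ u) (fun n => hH _) hK m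
  · simp only [Pi.add_apply]
    rw [integral_add (integrable_const _) hI4, integral_const, probReal_univ, one_smul]
    exact add_le_add_right hZsum _

omit hC in
-- Dominated convergence at each state; as there are finitely many states, one truncation level
-- serves all.
theorem exists_integral_excess_le {Y : M → ℝ}
    (hY : ∀ x, Integrable (fun p => Y p.2) (D.controlledKernel α x)) {ε : ℝ} (hε : 0 < ε) :
    ∃ K : ℝ, 0 ≤ K ∧ ∀ x, ∫ p, max (Y p.2 - K) 0 ∂(D.controlledKernel α x) ≤ ε := by
  have h : ∀ x, Tendsto (fun j : ℕ => ∫ p, max (Y p.2 - j) 0 ∂(D.controlledKernel α x)) atTop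
      (𝓝 (∫ p, (0 : ℝ) ∂(D.controlledKernel α x))) := fun x => by
    refine tendsto_integral_of_dominated_convergence (fun p => |Y p.2|) (fun j => ?_) (hY x).abs
      (fun j => ae_of_all _ fun p => ?_) (ae_of_all _ fun p => ?_)
    · exact (((hY x).sub (integrable_const (j : ℝ))).sup (integrable_const 0)).aestronglyMeasurable
    · rw [Real.norm_of_nonneg (le_max_right _ _)]
      exact max_le (by linarith [le_abs_self (Y p.2), (Nat.cast_nonneg j : (0 : ℝ) ≤ j)])
        (abs_nonneg _)
    · refine tendsto_const_nhds.congr' ?_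
      filter_upwards [tendsto_natCast_atTop_atTop.eventually_ge_atTop (Y p.2)] with j hj
      rw [max_eq_right (by linarith)]
  simp only [integral_zero] at h
  obtain ⟨j, hj⟩ := (eventually_all.2 fun x => (h x).eventually_le_const hε).exists
  exact ⟨j, Nat.cast_nonneg j, hj⟩

/-- Long-run mean income per unit time, given a solution of the Poisson equation. -/
theorem tendsto_V_div {g : ℝ} {h : State S → ℝ}
    (hpoisson : ∀ x, ∫ p, (D.income p.2 (D.dur p.2) - g * D.dur p.2 + h p.1 - h x)
      ∂(D.controlledKernel α x) = 0) :
    Tendsto (fun t => D.V α x₀ t / t) atTop (𝓝 g) := by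
  obtain ⟨B, hB, hBs, hBc⟩ := D.income_dominated
  have hBk := integrable_mark_kernel (α := α) hBs hBc
  obtain ⟨H, -, hH⟩ := exists_abs_le h
  have hC0 : 0 ≤ C := by simpa using hC 0 le_rfl 0
  rw [Metric.tendsto_atTop]
  intro δ hδ
  -- With this `ε` the excess costs at most `δ / 4 * (1 + t)`, hence at most `δ * t / 2` for `t ≥
  -- 1`; the threshold for `t` keeps `2 * H + K` below `δ * t / 4`. Using `C + 1` avoids division by
  -- zero.
  obtain ⟨K, hK, hKε⟩ := exists_integral_excess_le (α := α)
    (Y := fun m => 2 * B m + |g| * D.dur m) (ε := δ / (4 * (C + 1)))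
    (fun x => ((hBk x).const_mul 2).add ((integrable_dur x).const_mul |g|)) (by positivity)
  have hH0 : 0 ≤ H := (abs_nonneg _).trans (hH x₀)
  refine ⟨max 1 (4 * (2 * H + K) / δ), fun t ht => ?_⟩
  have ht1 : 1 ≤ t := (le_max_left _ _).trans ht
  have ht2 : 4 * (2 * H + K) ≤ t * δ := by
    rw [← div_le_iff₀ hδ]
    exact (le_max_right _ _).trans ht
  have key := abs_V_sub_le x₀ hC hpoisson hB hBk hH hK (by positivity) hKε (by linarith : 0 ≤ t)
  have e1 : δ / (4 * (C + 1)) * (C * (1 + t)) ≤ δ / 4 * (1 + t) := by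
    rw [← mul_assoc]
    refine mul_le_mul_of_nonneg_right ?_ (by linarith)
    rw [div_mul_eq_mul_div, div_le_div_iff₀ (by positivity) (by norm_num)]
    nlinarith
  have e2 : D.V α x₀ t / t - g = (D.V α x₀ t - g * t) / t := by
    field_simp
  rw [Real.dist_eq, e2, abs_div, abs_of_pos (by linarith : 0 < t), div_lt_iff₀ (by linarith)]
  nlinarith

end LongRun

end Model

/-! ### Balance of the mean durations and incomes -/

namespace Model

variable {S M : Type*} [Fintype S] [MeasurableSpace S] [MeasurableSingletonClass S]
  [MeasurableSpace M] {D : Model S M} (α : Fin 2 → stdSimplex ℝ S) [Nonempty M] [DecidableEq S]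
  (hb : ∀ k, D.absorptionProb k 0 + D.absorptionProb k 1 = 1)
include hb

/-- The balance of a functional of the marks, by its means over a control action and until
absorption. -/
theorem balance_integral_mark {φ : M → ℝ} (hs : ∀ k, Integrable (fun p => φ p.2) (D.stay k))
    (hc : ∀ i k, Integrable φ (D.control i k)) :
    D.balance α (fun x => ∫ p, φ p.2 ∂(D.controlledKernel α x)) =
      (∑ k, (α 0).1 k * (∫ m, φ m ∂(D.control 0 k) +
          ∫ ω, ∑' n, (if (chain (Sum.inr k) ω n).isRight then φ (mark (Sum.inr k) ω n) else 0)
            ∂(drawLaw D.absorbedKernel))) * (∑ l, (α 1).1 l * D.absorptionProb l 0) +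
        (∑ k, (α 1).1 k * (∫ m, φ m ∂(D.control 1 k) +
          ∫ ω, ∑' n, (if (chain (Sum.inr k) ω n).isRight then φ (mark (Sum.inr k) ω n) else 0)
            ∂(drawLaw D.absorbedKernel))) * (∑ l, (α 0).1 l * (1 - D.absorptionProb l 0)) := by
  have hb' : ∀ l, 1 - D.absorptionProb l 0 = D.absorptionProb l 1 := fun l => by
    linarith [hb l]
  simp only [hb', integral_until_absorption hb hs, mul_add, Finset.sum_add_distrib]
  rw [balance, integral_controlled α fun k => hc 0 k, integral_controlled α fun k => hc 1 k]
  rfl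

theorem balance_dur :
    D.balance α (fun x => ∫ p, D.dur p.2 ∂(D.controlledKernel α x)) =
      (∑ k, (α 0).1 k * (D.controlTime 0 k + D.meanTime k)) *
          (∑ l, (α 1).1 l * D.absorptionProb l 0) +
        (∑ k, (α 1).1 k * (D.controlTime 1 k + D.meanTime k)) *
          (∑ l, (α 0).1 l * (1 - D.absorptionProb l 0)) :=
  balance_integral_mark α hb D.dur_integrable_stay D.dur_integrable_control

theorem balance_income :
    D.balance α (fun x => ∫ p, D.income p.2 (D.dur p.2) ∂(D.controlledKernel α x)) =
      (∑ k, (α 0).1 k * (D.controlCost 0 k + D.meanIncome k)) *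
          (∑ l, (α 1).1 l * D.absorptionProb l 0) +
        (∑ k, (α 1).1 k * (D.controlCost 1 k + D.meanIncome k)) *
          (∑ l, (α 0).1 l * (1 - D.absorptionProb l 0)) := by
  obtain ⟨B, hB, hBs, hBc⟩ := D.income_dominated
  have hm : Measurable fun m => D.income m (D.dur m) :=
    D.income_measurable.comp (measurable_id.prodMk D.dur_measurable)
  have hle : ∀ m, |D.income m (D.dur m)| ≤ B m := fun m => hB m _ (D.dur_nonneg m) le_rfl
  exact balance_integral_mark (φ := fun m => D.income m (D.dur m)) α hb
    (fun k => (hBs k).mono' (hm.comp measurable_snd).aestronglyMeasurable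
      (ae_of_all _ fun p => hle p.2))
    (fun i k => (hBc i k).mono' hm.aestronglyMeasurable (ae_of_all _ hle))

theorem balance_dur_nonneg :
    0 ≤ D.balance α (fun x => ∫ p, D.dur p.2 ∂(D.controlledKernel α x)) := by
  have hb' : ∀ l, 1 - D.absorptionProb l 0 = D.absorptionProb l 1 := fun l => by
    linarith [hb l]
  have h1 : ∀ i k, 0 ≤ D.controlTime i k := fun i k => integral_nonneg D.dur_nonneg
  have h2 : ∀ k, 0 ≤ D.meanTime k := fun k => integral_nonneg fun ω =>
    tsum_nonneg fun n => by split_ifs; exacts [D.dur_nonneg _, le_rfl]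
  have h3 : ∀ k i, 0 ≤ D.absorptionProb k i := fun k i => measureReal_nonneg
  have h4 : ∀ i k, 0 ≤ (α i).1 k := fun i k => (α i).2.1 k
  rw [balance_dur α hb]
  simp only [hb']
  refine add_nonneg (mul_nonneg ?_ ?_) (mul_nonneg ?_ ?_) <;>
    refine Finset.sum_nonneg fun k _ => mul_nonneg (h4 _ _) ?_
  exacts [add_nonneg (h1 _ _) (h2 _), h3 _ _, add_nonneg (h1 _ _) (h2 _), h3 _ _]

/-- The balance is continuous in the reward and truncated means converge to the full ones.
Truncation is needed because the renewal bound requires a bounded overshoot. -/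
theorem exists_truncation_balance_pos
    (hpos : 0 < D.balance α (fun x => ∫ p, D.dur p.2 ∂(D.controlledKernel α x))) :
    ∃ K : ℝ, 0 ≤ K ∧
      0 < D.balance α (fun x => ∫ p, min (D.dur p.2) K ∂(D.controlledKernel α x)) := by
  have h : Tendsto (fun j : ℕ => fun x => ∫ p, min (D.dur p.2) j ∂(D.controlledKernel α x)) atTop
      (𝓝 fun x => ∫ p, D.dur p.2 ∂(D.controlledKernel α x)) := by
    refine tendsto_pi_nhds.2 fun x => ?_
    refine tendsto_integral_of_dominated_convergence (fun p => D.dur p.2) (fun j => ?_)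
      (integrable_dur x) (fun j => ae_of_all _ fun p => ?_) (ae_of_all _ fun p => ?_)
    · exact ((D.dur_measurable.comp measurable_snd).min measurable_const).aestronglyMeasurable
    · rw [Real.norm_of_nonneg (le_min (D.dur_nonneg _) (Nat.cast_nonneg j))]
      exact min_le_left _ _
    · refine tendsto_const_nhds.congr' ?_
      filter_upwards [tendsto_natCast_atTop_atTop.eventually_ge_atTop (D.dur p.2)] with j hj
      rw [min_eq_left hj]
  obtain ⟨j, hj⟩ := ((((continuous_balance D α).tendsto _).comp h).eventually_const_lt hpos).exists
  exact ⟨j, Nat.cast_nonneg j, hj⟩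

end Model

end Tuning
end

/-! ### Assembly of the theorem -/

open Tuning Tuning.Model in
theorem theorem2 {S M : Type*} [Fintype S] [MeasurableSpace S] [MeasurableSingletonClass S]
    [MeasurableSpace M] [Nonempty M] (D : Tuning.Model S M)
    (hb₀ : ∀ k, 0 < D.absorptionProb k 0) (hb₁ : ∀ k, 0 < D.absorptionProb k 1)
    (hb : ∀ k, D.absorptionProb k 0 + D.absorptionProb k 1 = 1)
    (α : Fin 2 → stdSimplex ℝ S) (num den : ℝ)
    (hnum : num =
      (∑ k, (α 0).1 k * (D.controlCost 0 k + D.meanIncome k)) *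
          (∑ l, (α 1).1 l * D.absorptionProb l 0) +
        (∑ k, (α 1).1 k * (D.controlCost 1 k + D.meanIncome k)) *
          (∑ l, (α 0).1 l * (1 - D.absorptionProb l 0)))
    (hden : den =
      (∑ k, (α 0).1 k * (D.controlTime 0 k + D.meanTime k)) *
          (∑ l, (α 1).1 l * D.absorptionProb l 0) +
        (∑ k, (α 1).1 k * (D.controlTime 1 k + D.meanTime k)) *
          (∑ l, (α 0).1 l * (1 - D.absorptionProb l 0)))
    (hden_ne : den ≠ 0) (x₀ : Tuning.State S) :
    (∀ᵐ ω ∂(Tuning.drawLaw (D.controlledKernel α)),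
      Tendsto (fun n => D.jumpTime x₀ ω n) atTop atTop) ∧
    (∀ t, Integrable (D.accumulated x₀ t) (Tuning.drawLaw (D.controlledKernel α))) ∧
    Tendsto (fun t : ℝ => D.V α x₀ t / t) atTop (𝓝 (num / den)) := by
  classical
  rw [← balance_dur α hb] at hden
  rw [← balance_income α hb] at hnum
  have hpos : 0 < den := lt_of_le_of_ne (hden ▸ balance_dur_nonneg α hb) hden_ne.symm
  obtain ⟨K, hK, hKpos⟩ := exists_truncation_balance_pos α hb (hden ▸ hpos)
  have hone := balance_one_pos α hb₀ hb₁ hb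
  set τ : State S → ℝ := fun x => ∫ p, min (D.dur p.2) K ∂(D.controlledKernel α x) with hτ
  -- Subtracting this constant balances `τ`. The Poisson solution `f` then makes the drift of
  -- truncated duration plus `f` equal to this positive constant at every state.
  have hc : 0 < D.balance α τ / D.balance α (fun _ => 1) := div_pos hKpos hone
  obtain ⟨f, hf⟩ := exists_poisson α hb₁ hb
    (ρ := fun x => τ x - D.balance α τ / D.balance α (fun _ => 1) * 1)
    (by rw [balance_sub_mul, div_mul_cancel₀ _ hone.ne', sub_self])
  obtain ⟨C, -, hC⟩ := exists_renewal_bound (D := D) (α := α) x₀ hc hK f fun x => by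
    have hi : Integrable (fun p : State S × M => min (D.dur p.2) K) (D.controlledKernel α x) :=
      (integrable_dur x).inf (integrable_const K)
    rw [integral_add hi (integrable_next f x)]
    linarith [hf x]
  refine ⟨ae_tendsto_jumpTime x₀ hC, integrable_accumulated x₀ hC, ?_⟩
  -- The value `num / den` is the rate at which income minus rate times duration becomes balanced.
  obtain ⟨h, hh⟩ := exists_poisson α hb₁ hb
    (ρ := fun x => ∫ p, D.income p.2 (D.dur p.2) ∂(D.controlledKernel α x) -
      num / den * ∫ p, D.dur p.2 ∂(D.controlledKernel α x))
    (by rw [balance_sub_mul, ← hnum, ← hden, div_mul_cancel₀ _ hden_ne, sub_self])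
  refine tendsto_V_div x₀ hC (h := h) fun x => ?_
  have hi := (integrable_dur (D := D) (α := α) x).const_mul (num / den)
  have hi2 : Integrable (fun p => D.income p.2 (D.dur p.2) - num / den * D.dur p.2)
      (D.controlledKernel α x) := (integrable_income x).sub hi
  have hi3 : Integrable (fun p => D.income p.2 (D.dur p.2) - num / den * D.dur p.2 + h p.1)
      (D.controlledKernel α x) := hi2.add (integrable_next h x)
  rw [integral_sub hi3 (integrable_const _), integral_add hi2 (integrable_next h x),
    integral_sub (integrable_income x) hi, integral_const_mul, hh x, integral_const,
    probReal_univ, one_smul, sub_self]
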